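/- All manifolds are finite-dimensional and smooth ($C^\infty$), as are all maps, forms and vector fields. Let $(M,\eta)$ be a contact manifold, i.e. $\dim M=2n+1$ and $\eta$ is a $1$-form on $M$ such that $(\mathsf{d}\eta)^n\wedge\eta$ vanishes at no point. Let $\Pi:M\to N$ be a surjective submersion, let $X$ be a vector field on $M$ (for instance the contact field $X_H$ of a function $H$), and let $\Lambda$ be a manifold with $\dim\Lambda+\dim N=\dim M$. Let $\Sigma:N\times\Lambda\to M$ be a complete solution of the $\Pi$-Hamilton–Jacobi equation for $X$, i.e. a surjective local diffeomorphism such that, for every $\lambda\in\Lambda$, the map $\sigma_\lambda:=\Sigma(\cdot,\lambda):N\to M$ is a section of $\Pi$ satisfying $(\sigma_\lambda)_*\circ\Pi_*\circ X\circ\sigma_\lambda=X\circ\sigma_\lambda$. Suppose that $\Sigma$ is pseudo-isotropic, i.e. $\sigma_\lambda^*\mathsf{d}\eta=0$ for all $\lambda\in\Lambda$. Let $W:N\times\Lambda\to\mathbb{R}$ be a smooth function such that the functions $W_\lambda:=W(\cdot,\lambda)$ satisfy $\mathsf{d}W_\lambda=\sigma_\lambda^*\eta$ for all $\lambda\in\Lambda$,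 and let $\varphi:N\times\Lambda\to T^*\Lambda$ be the map such that $\varphi(p,\lambda)\in T_\lambda^*\Lambda$ and $$\langle\varphi(p,\lambda),z\rangle=\langle(\mathsf{d}W-\Sigma^*\eta)(p,\lambda),(0,z)\rangle\qquad\text{for all }z\in T_\lambda\Lambda .$$ Write $\varphi_\lambda:=\varphi(\cdot,\lambda):N\to T_\lambda^*\Lambda$. Then, for every $\lambda\in\Lambda$, the map $(\varphi_\lambda,W_\lambda):N\to T_\lambda^*\Lambda\times\mathbb{R}$ is an immersion (a smooth map with injective differential at every point). Consequently, $(\varphi,W):N\times\Lambda\to T^*\Lambda\times\mathbb{R}$ is an immersion. -/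

import Mathlib

open scoped Manifold ContDiff
open Bundle Module

noncomputable section

namespace ContactHJ

/-! All manifolds are smooth, without boundary, and modelled on finite-dimensional real normed
spaces; `E`, `E'` are such model spaces. -/

section Forms

variable {E : Type*} [NormedAddCommGroup E] [NormedSpace ℝ E]
  {M : Type*} [TopologicalSpace M] [ChartedSpace E M]

/-- The cotangent bundle `T*M`, with the smooth structure that Mathlib puts on the bundle of
continuous linear maps from the tangent bundle to the trivial line bundle. -/
abbrev CotangentBundle (E : Type*) [NormedAddCommGroup E] [NormedSpace ℝ E]
    (M : Type*) [TopologicalSpace M] [ChartedSpace E M] [IsManifold 𝓘(ℝ, E) ∞ M] : Type _ :=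
  TotalSpace (E →L[ℝ] ℝ) (fun p : M => TangentSpace 𝓘(ℝ, E) p →L[ℝ] ℝ)

/-- A (not necessarily smooth) `1`-form: a choice of covector at every point. -/
abbrev OneForm (E : Type*) [NormedAddCommGroup E] [NormedSpace ℝ E]
    (M : Type*) [TopologicalSpace M] [ChartedSpace E M] : Type _ :=
  (p : M) → (TangentSpace 𝓘(ℝ, E) p →L[ℝ] ℝ)

/-- A `1`-form is smooth if it is a smooth section of the cotangent bundle. -/
def OneForm.IsSmooth [IsManifold 𝓘(ℝ, E) ∞ M] (η : OneForm E M) : Prop :=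
  ContMDiff 𝓘(ℝ, E) (𝓘(ℝ, E).prod 𝓘(ℝ, E →L[ℝ] ℝ)) ∞
    (fun p => (⟨p, η p⟩ : CotangentBundle E M))

/-- The pull-back `ψ^*η` of a `1`-form by the inverse `ψ` of the chart at `p`, regarded as a
`1`-form on the model space. -/
def OneForm.inChart (η : OneForm E M) (p : M) (y : E) : E [⋀^Fin 1]→L[ℝ] ℝ :=
  ContinuousAlternatingMap.ofSubsingleton ℝ E ℝ (0 : Fin 1)
    ((η ((extChartAt 𝓘(ℝ, E) p).symm y)).comp
      (mfderiv 𝓘(ℝ, E) 𝓘(ℝ, E) (extChartAt 𝓘(ℝ, E) p).symm y))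

/-- The exterior derivative `dη` at `p`, computed in the chart at `p`: the exterior derivative of
the form written in the chart, pulled back by the chart. (For smooth `η` any other chart around `p`
gives the same value.) -/
def OneForm.extDeriv (η : OneForm E M) (p : M) : TangentSpace 𝓘(ℝ, E) p [⋀^Fin 2]→L[ℝ] ℝ :=
  (_root_.extDeriv (η.inChart p) (extChartAt 𝓘(ℝ, E) p p)).compContinuousLinearMap
    (mfderiv 𝓘(ℝ, E) 𝓘(ℝ, E) (extChartAt 𝓘(ℝ, E) p) p)

/-- The value on `v` of the `(2n+1)`-form `β ∧ ⋯ ∧ β ∧ θ` (`n` factors `β`), for a `2`-form `β` and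
a `1`-form `θ` on a vector space:
`(1 / (2!)^n) ∑_s sign(s) β(v_{s(0)}, v_{s(1)}) ⋯ β(v_{s(2n-2)}, v_{s(2n-1)}) θ(v_{s(2n)})`. -/
def powWedge {V : Type*} [AddCommGroup V] [Module ℝ V] [TopologicalSpace V] (n : ℕ)
    (β : V [⋀^Fin 2]→L[ℝ] ℝ) (θ : V →L[ℝ] ℝ) (v : Fin (2 * n + 1) → V) : ℝ :=
  (2 ^ n : ℝ)⁻¹ * ∑ s : Equiv.Perm (Fin (2 * n + 1)), ((Equiv.Perm.sign s : ℤ) : ℝ) *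
    ((∏ i : Fin n, β ![v (s ⟨2 * (i : ℕ), by omega⟩), v (s ⟨2 * (i : ℕ) + 1, by omega⟩)]) *
      θ (v (s (Fin.last (2 * n)))))

/-- `(M, η)` is a contact manifold of dimension `2n+1`: `η` is a smooth `1`-form and
`(dη)^n ∧ η` vanishes at no point. -/
structure IsContactForm [IsManifold 𝓘(ℝ, E) ∞ M] (n : ℕ) (η : OneForm E M) : Prop where
  finrank_eq : finrank ℝ E = 2 * n + 1
  isSmooth : η.IsSmooth
  ne_zero : ∀ p : M, ∃ v : Fin (2 * n + 1) → TangentSpace 𝓘(ℝ, E) p,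
    powWedge n (η.extDeriv p) (η p) v ≠ 0

end Forms

section Maps

variable {E : Type*} [NormedAddCommGroup E] [NormedSpace ℝ E]
  {E' : Type*} [NormedAddCommGroup E'] [NormedSpace ℝ E']
  {H : Type*} [TopologicalSpace H] {H' : Type*} [TopologicalSpace H']
  {M : Type*} [TopologicalSpace M] [ChartedSpace H M]
  {M' : Type*} [TopologicalSpace M'] [ChartedSpace H' M']

/-- The differential `dW` of a real function, as a covector at every point. -/
def differential (I : ModelWithCorners ℝ E H) (W : M → ℝ) (x : M) : TangentSpace I x →L[ℝ] ℝ :=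
  mfderiv I 𝓘(ℝ, ℝ) W x

/-- The pull-back `f^*η` of a `1`-form `η`. -/
def OneForm.pullback {Q : Type*} [TopologicalSpace Q] [ChartedSpace E' Q]
    (I : ModelWithCorners ℝ E H) (f : M → Q) (η : OneForm E' Q) (x : M) :
    TangentSpace I x →L[ℝ] ℝ :=
  (η (f x)).comp (mfderiv I 𝓘(ℝ, E') f x)

/-- A smooth immersion between finite-dimensional manifolds: a smooth map whose differential is
injective at every point. -/
structure IsSmoothImmersion (I : ModelWithCorners ℝ E H) (I' : ModelWithCorners ℝ E' H')
    (f : M → M') : Prop where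
  contMDiff : ContMDiff I I' ∞ f
  injective_mfderiv : ∀ x : M, Function.Injective (mfderiv I I' f x)

/-- A fibration: a smooth surjective submersion. -/
structure IsFibration (I : ModelWithCorners ℝ E H) (I' : ModelWithCorners ℝ E' H')
    (f : M → M') : Prop where
  contMDiff : ContMDiff I I' ∞ f
  surjective : Function.Surjective f
  surjective_mfderiv : ∀ x : M, Function.Surjective (mfderiv I I' f x)

end Maps

section HamiltonJacobi

variable {EM EN EL : Type*}
  [NormedAddCommGroup EM] [NormedSpace ℝ EM]
  [NormedAddCommGroup EN] [NormedSpace ℝ EN]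
  [NormedAddCommGroup EL] [NormedSpace ℝ EL]
  {M N L : Type*}
  [TopologicalSpace M] [ChartedSpace EM M]
  [TopologicalSpace N] [ChartedSpace EN N]
  [TopologicalSpace L] [ChartedSpace EL L]

/-- `σ` is a solution of the `Π`-Hamilton-Jacobi equation for the vector field `X`: a smooth section
of `Π` with `σ_* ∘ Π_* ∘ X ∘ σ = X ∘ σ`. -/
structure IsSolution (P : M → N) (X : (m : M) → TangentSpace 𝓘(ℝ, EM) m) (σ : N → M) :
    Prop where
  contMDiff : ContMDiff 𝓘(ℝ, EN) 𝓘(ℝ, EM) ∞ σ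
  isSection : ∀ p : N, P (σ p) = p
  hamilton_jacobi : ∀ p : N,
    mfderiv 𝓘(ℝ, EN) 𝓘(ℝ, EM) σ p (mfderiv 𝓘(ℝ, EM) 𝓘(ℝ, EN) P (σ p) (X (σ p))) = X (σ p)

/-- `S : N × L → M` is a complete solution of the `Π`-Hamilton-Jacobi equation for `X`. -/
structure IsCompleteSolution (P : M → N) (X : (m : M) → TangentSpace 𝓘(ℝ, EM) m)
    (S : N × L → M) : Prop where
  finrank_add : finrank ℝ EL + finrank ℝ EN = finrank ℝ EM
  surjective : Function.Surjective S
  isLocalDiffeomorph : IsLocalDiffeomorph (𝓘(ℝ, EN).prod 𝓘(ℝ, EL)) 𝓘(ℝ, EM) ∞ S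
  isSolution : ∀ l : L, IsSolution (EN := EN) P X (fun p => S (p, l))

/-- `S` is pseudo-isotropic: `σ_l^* dη = 0` for every `l`, where `σ_l = S(·, l)`. -/
def IsPseudoIsotropic (EN : Type*) [NormedAddCommGroup EN] [NormedSpace ℝ EN]
    [ChartedSpace EN N] (η : OneForm EM M) (S : N × L → M) : Prop :=
  ∀ (l : L) (p : N), (η.extDeriv (S (p, l))).compContinuousLinearMap
    (mfderiv 𝓘(ℝ, EN) 𝓘(ℝ, EM) (fun p' : N => S (p', l)) p) = 0

end HamiltonJacobi

end ContactHJ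

end

/-! Put `α = dW - S^*η` on `N × L`. The condition on `dW_l` says that `α` kills the vectors `(v,
0)`, so `α` is determined by its `L`-part, which is `φ`. Moreover `dα = -S^*dη`.

Let `v` be in the kernel of the differential of `(φ_l, W_l)`. Since `α(v, 0)` vanishes identically,
`dα((v, 0), (0, z))` is, in a product chart, the derivative of `α(0, z)` along `(v, 0)`, that is
`⟨dφ_l(v), z⟩ = 0` (`fderiv_defectForm_inl_inr`). Hence `dη(S_*(v, 0), S_*(0, z)) = 0` for all `z`,
while `dη(S_*(v, 0), S_*(w, 0)) = 0` for all `w` by pseudo-isotropy. As `S` is a local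
diffeomorphism, `S_*(v, 0)` lies in the kernel of `dη`. It also lies in the kernel of `η`, because
`η(S_*(v, 0)) = dW_l(v) = 0`. On a contact manifold these kernels meet only in `0`
(`eq_zero_of_powWedge_ne_zero`), so `v = 0` (`eq_zero_of_fderiv_defectForm_eq_zero`).

For `(φ, W)` on `N × L`, the base point of `φ(p, l)` is `l`, so a kernel vector has the form `(v,
0)` and the same argument applies. Working in charts turns `dα` into ordinary second derivatives. -/

namespace ContactHJ

/-! ### Linear algebra of the contact condition -/

section LinearAlgebra

variable {V : Type*} [AddCommGroup V] [Module ℝ V] [TopologicalSpace V]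

theorem map_pair_swap (β : V [⋀^Fin 2]→L[ℝ] ℝ) (a b : V) : β ![a, b] = -β ![b, a] := by
  have h := β.toAlternatingMap.map_swap ![b, a] (i := 0) (j := 1) (by decide)
  have e : (![b, a] ∘ Equiv.swap 0 1 : Fin 2 → V) = ![a, b] := by
    ext i; fin_cases i <;> simp
  rw [e] at h
  exact h

theorem map_pair_add_left (β : V [⋀^Fin 2]→L[ℝ] ℝ) (a b c : V) :
    β ![a + b, c] = β ![a, c] + β ![b, c] :=
  β.vecCons_add ![c] a b

theorem map_pair_smul_left (β : V [⋀^Fin 2]→L[ℝ] ℝ) (r : ℝ) (a c : V) :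
    β ![r • a, c] = r * β ![a, c] :=
  β.vecCons_smul ![c] r a

theorem map_pair_add_right (β : V [⋀^Fin 2]→L[ℝ] ℝ) (a b c : V) :
    β ![a, b + c] = β ![a, b] + β ![a, c] := by
  rw [map_pair_swap, map_pair_add_left, neg_add, ← map_pair_swap, ← map_pair_swap]

theorem map_pair_smul_right (β : V [⋀^Fin 2]→L[ℝ] ℝ) (r : ℝ) (a c : V) :
    β ![a, r • c] = r * β ![a, c] := by
  rw [map_pair_swap, map_pair_smul_left, ← mul_neg, ← map_pair_swap]

/-- The positions of the arguments of `β ∧ ⋯ ∧ β ∧ θ`: two for each factor `β`, one for `θ`. -/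
theorem index_cases (n : ℕ) (k : Fin (2 * n + 1)) :
    k = Fin.last (2 * n) ∨ (∃ i : Fin n, k = ⟨2 * (i : ℕ), by omega⟩) ∨
      ∃ i : Fin n, k = ⟨2 * (i : ℕ) + 1, by omega⟩ := by
  by_cases h : (k : ℕ) = 2 * n
  · exact Or.inl (Fin.ext h)
  · obtain ⟨j, hj⟩ := Nat.even_or_odd' (k : ℕ)
    rcases hj with hj | hj
    · exact Or.inr (Or.inl ⟨⟨j, by omega⟩, Fin.ext hj⟩)
    · exact Or.inr (Or.inr ⟨⟨j, by omega⟩, Fin.ext hj⟩)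

/-- The product `β(v₀, v₁) ⋯ β(v₂ₙ₋₂, v₂ₙ₋₁) θ(v₂ₙ)`. -/
def blockProd (n : ℕ) (β : V [⋀^Fin 2]→L[ℝ] ℝ) (θ : V →L[ℝ] ℝ)
    (v : Fin (2 * n + 1) → V) : ℝ :=
  (∏ i : Fin n, β ![v ⟨2 * (i : ℕ), by omega⟩, v ⟨2 * (i : ℕ) + 1, by omega⟩]) *
    θ (v (Fin.last (2 * n)))

/-- In each slot, `blockProd` is a linear functional of the entry. -/
theorem exists_linear_blockProd_update (n : ℕ) (β : V [⋀^Fin 2]→L[ℝ] ℝ) (θ : V →L[ℝ] ℝ)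
    (v : Fin (2 * n + 1) → V) (k : Fin (2 * n + 1)) :
    ∃ f : V →ₗ[ℝ] ℝ, ∀ x, blockProd n β θ (Function.update v k x) = f x := by
  -- Each slot occurs in exactly one factor and that factor is linear in it; the product of the
  -- remaining factors is a scalar.
  rcases index_cases n k with rfl | ⟨j, rfl⟩ | ⟨j, rfl⟩
  · refine ⟨(∏ i : Fin n, β ![v ⟨2 * (i : ℕ), by omega⟩, v ⟨2 * (i : ℕ) + 1, by omega⟩]) •
      (θ : V →ₗ[ℝ] ℝ), fun x => ?_⟩
    have h1 (i : Fin n) : (⟨2 * (i : ℕ), by omega⟩ : Fin (2 * n + 1)) ≠ Fin.last (2 * n) :=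
      fun h => by have := congrArg Fin.val h; simp at this; omega
    have h2 (i : Fin n) : (⟨2 * (i : ℕ) + 1, by omega⟩ : Fin (2 * n + 1)) ≠ Fin.last (2 * n) :=
      fun h => by have := congrArg Fin.val h; simp at this; omega
    simp [blockProd, Function.update_of_ne (h1 _), Function.update_of_ne (h2 _)]
  · let g : V →ₗ[ℝ] ℝ :=
      { toFun := fun x => β ![x, v ⟨2 * (j : ℕ) + 1, by omega⟩]
        map_add' := fun a b => map_pair_add_left β a b _
        map_smul' := fun r a => map_pair_smul_left β r a _ }
    refine ⟨((∏ i ∈ Finset.univ.erase j,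
      β ![v ⟨2 * (i : ℕ), by omega⟩, v ⟨2 * (i : ℕ) + 1, by omega⟩]) *
        θ (v (Fin.last (2 * n)))) • g, fun x => ?_⟩
    have h0 : Fin.last (2 * n) ≠ (⟨2 * (j : ℕ), by omega⟩ : Fin (2 * n + 1)) :=
      fun h => by have := congrArg Fin.val h; simp at this; omega
    have h1 (i : Fin n) (hi : i ≠ j) : (⟨2 * (i : ℕ), by omega⟩ : Fin (2 * n + 1)) ≠
        ⟨2 * (j : ℕ), by omega⟩ :=
      fun h => hi (Fin.ext (by have := congrArg Fin.val h; simp at this; omega))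
    have h2 (i : Fin n) : (⟨2 * (i : ℕ) + 1, by omega⟩ : Fin (2 * n + 1)) ≠
        ⟨2 * (j : ℕ), by omega⟩ :=
      fun h => by have := congrArg Fin.val h; simp at this; omega
    rw [blockProd, ← Finset.mul_prod_erase _ _ (Finset.mem_univ j), Function.update_self,
      Function.update_of_ne (h2 j), Function.update_of_ne h0, Finset.prod_congr rfl fun i hi => by
        rw [Function.update_of_ne (h1 i (Finset.ne_of_mem_erase hi)),
          Function.update_of_ne (h2 i)]]
    simp only [LinearMap.smul_apply, smul_eq_mul, g, LinearMap.coe_mk, AddHom.coe_mk]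
    ring
  · let g : V →ₗ[ℝ] ℝ :=
      { toFun := fun x => β ![v ⟨2 * (j : ℕ), by omega⟩, x]
        map_add' := fun a b => map_pair_add_right β _ a b
        map_smul' := fun r a => map_pair_smul_right β r _ a }
    refine ⟨((∏ i ∈ Finset.univ.erase j,
      β ![v ⟨2 * (i : ℕ), by omega⟩, v ⟨2 * (i : ℕ) + 1, by omega⟩]) *
        θ (v (Fin.last (2 * n)))) • g, fun x => ?_⟩
    have h0 : Fin.last (2 * n) ≠ (⟨2 * (j : ℕ) + 1, by omega⟩ : Fin (2 * n + 1)) :=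
      fun h => by have := congrArg Fin.val h; simp at this; omega
    have h1 (i : Fin n) (hi : i ≠ j) : (⟨2 * (i : ℕ) + 1, by omega⟩ : Fin (2 * n + 1)) ≠
        ⟨2 * (j : ℕ) + 1, by omega⟩ :=
      fun h => hi (Fin.ext (by have := congrArg Fin.val h; simp at this; omega))
    have h2 (i : Fin n) : (⟨2 * (i : ℕ), by omega⟩ : Fin (2 * n + 1)) ≠
        ⟨2 * (j : ℕ) + 1, by omega⟩ :=
      fun h => by have := congrArg Fin.val h; simp at this; omega
    rw [blockProd, ← Finset.mul_prod_erase _ _ (Finset.mem_univ j), Function.update_self,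
      Function.update_of_ne (h2 j), Function.update_of_ne h0, Finset.prod_congr rfl fun i hi => by
        rw [Function.update_of_ne (h1 i (Finset.ne_of_mem_erase hi)),
          Function.update_of_ne (h2 i)]]
    simp only [LinearMap.smul_apply, smul_eq_mul, g, LinearMap.coe_mk, AddHom.coe_mk]
    ring

/-- `blockProd` as a multilinear map. -/
def blockProdMultilinear (n : ℕ) (β : V [⋀^Fin 2]→L[ℝ] ℝ) (θ : V →L[ℝ] ℝ) :
    MultilinearMap ℝ (fun _ : Fin (2 * n + 1) => V) ℝ where
  toFun := blockProd n β θ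
  map_update_add' {dec} v k x y := by
    -- The field quantifies over every decidable equality on the index type, whereas the lemma uses
    -- the standard one.
    cases Subsingleton.elim dec (instDecidableEqFin _)
    obtain ⟨f, hf⟩ := exists_linear_blockProd_update n β θ v k
    simp only [hf, map_add]
  map_update_smul' {dec} v k c x := by
    cases Subsingleton.elim dec (instDecidableEqFin _)
    obtain ⟨f, hf⟩ := exists_linear_blockProd_update n β θ v k
    simp only [hf, map_smul]

/-- This makes the explicit sum an alternating map, which therefore vanishes on linearly dependent
families. -/
theorem powWedge_eq_alternatization (n : ℕ) (β : V [⋀^Fin 2]→L[ℝ] ℝ) (θ : V →L[ℝ] ℝ)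
    (v : Fin (2 * n + 1) → V) :
    powWedge n β θ v =
      (2 ^ n : ℝ)⁻¹ * MultilinearMap.alternatization (blockProdMultilinear n β θ) v := by
  rw [powWedge, MultilinearMap.alternatization_apply]
  congr 1
  refine Finset.sum_congr rfl fun s _ => ?_
  rw [Units.smul_def, zsmul_eq_mul]
  rfl

theorem powWedge_eq_zero_of_not_linearIndependent (n : ℕ) (β : V [⋀^Fin 2]→L[ℝ] ℝ)
    (θ : V →L[ℝ] ℝ) (v : Fin (2 * n + 1) → V) (hv : ¬LinearIndependent ℝ v) :
    powWedge n β θ v = 0 := by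
  rw [powWedge_eq_alternatization, AlternatingMap.map_linearDependent _ v hv, mul_zero]

/-- If `β ∧ ⋯ ∧ β ∧ θ` is a non-zero form of top degree, then no non-zero vector is in the kernel
of both `β` and `θ`. -/
theorem eq_zero_of_powWedge_ne_zero {n : ℕ} (hV : finrank ℝ V = 2 * n + 1)
    {β : V [⋀^Fin 2]→L[ℝ] ℝ} {θ : V →L[ℝ] ℝ} {v : Fin (2 * n + 1) → V}
    (hv : powWedge n β θ v ≠ 0) {u : V} (hβ : ∀ w, β ![u, w] = 0) (hθ : θ u = 0) : u = 0 := by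
  by_contra hu
  have : FiniteDimensional ℝ V := FiniteDimensional.of_finrank_pos (by omega)
  obtain ⟨f, hf⟩ : ∃ f : Module.Dual ℝ V, f u = 1 := by
    obtain ⟨f, hf⟩ := not_forall.1 (mt (Module.forall_dual_apply_eq_zero_iff ℝ u).1 hu)
    exact ⟨(f u)⁻¹ • f, by simp [hf]⟩
  -- The projection onto the hyperplane `ker f` along `u`. Neither `β` nor `θ` sees the component
  -- along `u`, so replacing `v` by `p ∘ v` leaves the wedge unchanged.
  let p : V → V := fun x => x - f x • u
  have hpβ (x y : V) : β ![p x, p y] = β ![x, y] := by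
    have h1 : β ![x, u] = 0 := by rw [map_pair_swap, hβ, neg_zero]
    simp only [p, sub_eq_add_neg, ← neg_smul, map_pair_add_left, map_pair_add_right,
      map_pair_smul_left, map_pair_smul_right, hβ, h1]
    ring
  have hpθ (x : V) : θ (p x) = θ x := by simp [p, hθ]
  have hp : powWedge n β θ v = powWedge n β θ (p ∘ v) := by
    simp only [powWedge, Function.comp_apply, hpβ, hpθ]
  -- The `2n+1` vectors `p (v i)` lie in a proper subspace of a `(2n+1)`-dimensional space; if
  -- independent they would span it, and `u` would be in `ker f`.
  refine hv (hp.trans (powWedge_eq_zero_of_not_linearIndependent n β θ _ fun hli => ?_))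
  have htop := hli.span_eq_top_of_card_eq_finrank (by simp [hV])
  have hle : Submodule.span ℝ (Set.range (p ∘ v)) ≤ LinearMap.ker f := by
    rw [Submodule.span_le]
    rintro _ ⟨i, rfl⟩
    simp [p, hf]
  have hmem : u ∈ LinearMap.ker f := hle (htop ▸ Submodule.mem_top)
  rw [LinearMap.mem_ker, hf] at hmem
  exact one_ne_zero hmem

end LinearAlgebra

/-! ### Exterior derivatives of 1-forms on normed spaces -/

section Calculus

variable {E : Type*} [NormedAddCommGroup E] [NormedSpace ℝ E]
  {F : Type*} [NormedAddCommGroup F] [NormedSpace ℝ F]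

/-- The invariant formula for `da` on the constant fields `u`, `w`, whose bracket is zero. -/
theorem extDeriv_ofSubsingleton_apply {a : E → E →L[ℝ] ℝ} {x : E} (ha : DifferentiableAt ℝ a x)
    (u w : E) :
    _root_.extDeriv (fun y => ContinuousAlternatingMap.ofSubsingleton ℝ E ℝ (0 : Fin 1) (a y)) x
      ![u, w] = fderiv ℝ a x u w - fderiv ℝ a x w u := by
  have hd : DifferentiableAt ℝ
      (fun y => ContinuousAlternatingMap.ofSubsingleton ℝ E ℝ (0 : Fin 1) (a y)) x :=
    (ContinuousAlternatingMap.ofSubsingletonLIE (𝕜 := ℝ) (E := E) (F := ℝ)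
      (0 : Fin 1)).differentiableAt.comp x ha
  have happ (z : E) : fderiv ℝ (fun y => a y z) x = (fderiv ℝ a x).flip z := by
    rw [fderiv_clm_apply ha (differentiableAt_const z)]
    simp
  rw [_root_.extDeriv_apply hd, Fin.sum_univ_two]
  simp [happ, Fin.removeNth, sub_eq_add_neg]

/-- `d(dW - S^*θ) = -S^*dθ` on a normed space. -/
theorem fderiv_sub_pullback_antisymm {W : E → ℝ} {S : E → F} {θ : F → F →L[ℝ] ℝ} {x : E}
    (hW : ContDiffAt ℝ ∞ W x) (hS : ContDiffAt ℝ ∞ S x) (hθ : DifferentiableAt ℝ θ (S x))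
    (u w : E) :
    fderiv ℝ (fun y => fderiv ℝ W y - (θ (S y)).comp (fderiv ℝ S y)) x u w -
      fderiv ℝ (fun y => fderiv ℝ W y - (θ (S y)).comp (fderiv ℝ S y)) x w u =
    -_root_.extDeriv (fun y => ContinuousAlternatingMap.ofSubsingleton ℝ F ℝ (0 : Fin 1) (θ y))
      (S x) ![fderiv ℝ S x u, fderiv ℝ S x w] := by
  have h1 : DifferentiableAt ℝ (fderiv ℝ W) x :=
    (hW.fderiv_right (m := 1) (by norm_cast)).differentiableAt one_ne_zero
  have h2 : DifferentiableAt ℝ (fderiv ℝ S) x :=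
    (hS.fderiv_right (m := 1) (by norm_cast)).differentiableAt one_ne_zero
  have h3 : DifferentiableAt ℝ S x := hS.differentiableAt (by simp)
  have h4 : DifferentiableAt ℝ (fun y => θ (S y)) x := hθ.comp x h3
  -- Symmetry of second derivatives cancels the terms in `D²W` and `D²S`; only the derivative of `θ`
  -- survives.
  have s1 := hW.isSymmSndFDerivAt (by simp; norm_cast) u w
  have s2 := hS.isSymmSndFDerivAt (by simp; norm_cast) u w
  have h5 : fderiv ℝ (fun y => θ (S y)) x = (fderiv ℝ θ (S x)).comp (fderiv ℝ S x) :=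
    fderiv_comp x hθ h3
  rw [extDeriv_ofSubsingleton_apply hθ, fderiv_fun_sub h1 (h4.clm_comp h2),
    fderiv_clm_comp h4 h2, h5]
  simp [s1, s2]

end Calculus

/-! ### One-forms and the cotangent bundle in charts -/

section Charts

open scoped Topology

variable {E : Type*} [NormedAddCommGroup E] [NormedSpace ℝ E]
  {M : Type*} [TopologicalSpace M] [ChartedSpace E M]

/-- The pull-back of a `1`-form by the inverse of the chart at `p`, as a map to the dual space. -/
noncomputable def OneForm.chartForm (η : OneForm E M) (p : M) (y : E) : E →L[ℝ] ℝ :=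
  (η ((extChartAt 𝓘(ℝ, E) p).symm y)).comp
    (mfderiv 𝓘(ℝ, E) 𝓘(ℝ, E) (extChartAt 𝓘(ℝ, E) p).symm y)

variable [IsManifold 𝓘(ℝ, E) ∞ M]

/-- Links the bundle to charts: smoothness into the cotangent bundle is tested in this
trivialisation, and the right-hand side is what chart computations produce. -/
theorem inCoordinates_cotangent {l₀ l : M} (hl : l ∈ (chartAt E l₀).source)
    (α : TangentSpace 𝓘(ℝ, E) l →L[ℝ] ℝ) :
    ContinuousLinearMap.inCoordinates E (TangentSpace 𝓘(ℝ, E)) ℝ (fun _ : M => ℝ)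
      l₀ l l₀ l α =
    α.comp (mfderiv 𝓘(ℝ, E) 𝓘(ℝ, E) (extChartAt 𝓘(ℝ, E) l₀).symm
      (extChartAt 𝓘(ℝ, E) l₀ l)) := by
  have := TangentBundle.symmL_trivializationAt (𝕜 := ℝ) (I := 𝓘(ℝ, E)) hl
  simp only [modelWithCornersSelf_coe, Set.range_id, mfderivWithin_univ] at this
  rw [ContinuousLinearMap.inCoordinates, this]
  ext v
  simp
  rfl

/-- The tangent space at `p` is identified with `E` through the preferred chart at `p`, so that
chart has identity differential at its own centre. -/
theorem mfderiv_extChartAt_symm_self (p : M) :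
    mfderiv 𝓘(ℝ, E) 𝓘(ℝ, E) (extChartAt 𝓘(ℝ, E) p).symm (extChartAt 𝓘(ℝ, E) p p) =
      ContinuousLinearMap.id ℝ E := by
  have := mfderivWithin_range_extChartAt_symm (𝕜 := ℝ) (I := 𝓘(ℝ, E)) (x := p)
  simp only [modelWithCornersSelf_coe, Set.range_id, mfderivWithin_univ] at this
  exact this

theorem mdifferentiableAt_extChartAt_symm_self {p : M} {y : E}
    (hy : y ∈ (extChartAt 𝓘(ℝ, E) p).target) :
    MDifferentiableAt 𝓘(ℝ, E) 𝓘(ℝ, E) (extChartAt 𝓘(ℝ, E) p).symm y := by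
  have := mdifferentiableWithinAt_extChartAt_symm (𝕜 := ℝ) (I := 𝓘(ℝ, E)) hy
  simpa only [modelWithCornersSelf_coe, Set.range_id, mdifferentiableWithinAt_univ] using this

theorem contMDiffAt_extChartAt_symm_self (p : M) :
    ContMDiffAt 𝓘(ℝ, E) 𝓘(ℝ, E) ∞ (extChartAt 𝓘(ℝ, E) p).symm (extChartAt 𝓘(ℝ, E) p p) :=
  (contMDiffOn_extChartAt_symm p).contMDiffAt (extChartAt_target_mem_nhds p)

theorem mfderiv_extChartAt_symm_comp_mfderiv_extChartAt {p m : M}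
    (hm : m ∈ (extChartAt 𝓘(ℝ, E) p).source) (u : TangentSpace 𝓘(ℝ, E) m) :
    (mfderiv 𝓘(ℝ, E) 𝓘(ℝ, E) (extChartAt 𝓘(ℝ, E) p).symm (extChartAt 𝓘(ℝ, E) p m)
      (mfderiv 𝓘(ℝ, E) 𝓘(ℝ, E) (extChartAt 𝓘(ℝ, E) p) m u) : E) = u := by
  have := mfderivWithin_extChartAt_symm_comp_mfderiv_extChartAt' (𝕜 := ℝ) (I := 𝓘(ℝ, E)) hm
  simp only [modelWithCornersSelf_coe, Set.range_id, mfderivWithin_univ] at this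
  exact congrArg (fun f : E →L[ℝ] E => f u) this

theorem OneForm.chartForm_mfderiv (η : OneForm E M) {p m : M}
    (hm : m ∈ (extChartAt 𝓘(ℝ, E) p).source) (u : TangentSpace 𝓘(ℝ, E) m) :
    η.chartForm p (extChartAt 𝓘(ℝ, E) p m)
      (mfderiv 𝓘(ℝ, E) 𝓘(ℝ, E) (extChartAt 𝓘(ℝ, E) p) m u) = η m u := by
  have h := (extChartAt 𝓘(ℝ, E) p).left_inv hm
  -- The fibre containing `η m'` depends on `m'`; viewing all fibres as `E →L[ℝ] ℝ` allows the base
  -- point to be rewritten.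
  have h1 : (η ((extChartAt 𝓘(ℝ, E) p).symm (extChartAt 𝓘(ℝ, E) p m)) : E →L[ℝ] ℝ) = η m :=
    congrArg (fun m' : M => show E →L[ℝ] ℝ from η m') h
  have h2 := mfderiv_extChartAt_symm_comp_mfderiv_extChartAt hm u
  change (η ((extChartAt 𝓘(ℝ, E) p).symm (extChartAt 𝓘(ℝ, E) p m)) : E →L[ℝ] ℝ) _ = _
  rw [h1]
  exact congrArg (η m : E →L[ℝ] ℝ) h2

theorem OneForm.IsSmooth.contDiffAt_chartForm {η : OneForm E M} (hη : η.IsSmooth) (p : M) :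
    ContDiffAt ℝ ∞ (η.chartForm p) (extChartAt 𝓘(ℝ, E) p p) := by
  have h := ((contMDiffAt_hom_bundle _).1 (hη p)).2
  have hs := contMDiffAt_extChartAt_symm_self (E := E) p
  have hp : (extChartAt 𝓘(ℝ, E) p).symm (extChartAt 𝓘(ℝ, E) p p) = p := extChartAt_to_inv p
  rw [← hp] at h
  have h' := (ContMDiffAt.comp _ h hs).contDiffAt
  rw [hp] at h'
  refine h'.congr_of_eventuallyEq ?_
  filter_upwards [extChartAt_target_mem_nhds (I := 𝓘(ℝ, E)) p] with y hy
  have hy' := (extChartAt 𝓘(ℝ, E) p).map_target hy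
  rw [extChartAt_source] at hy'
  simp only [Function.comp_apply]
  rw [inCoordinates_cotangent hy', (extChartAt 𝓘(ℝ, E) p).right_inv hy]
  rfl

/-- The pull-back by the chart in the definition of `dη` disappears because its differential at `p`
is the identity. -/
theorem OneForm.extDeriv_apply (η : OneForm E M) (p : M) (u w : TangentSpace 𝓘(ℝ, E) p) :
    η.extDeriv p ![u, w] = _root_.extDeriv (fun y =>
      ContinuousAlternatingMap.ofSubsingleton ℝ E ℝ (0 : Fin 1) (η.chartForm p y))
        (extChartAt 𝓘(ℝ, E) p p) ![(u : E), (w : E)] := by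
  have h (z : TangentSpace 𝓘(ℝ, E) p) :
      (mfderiv 𝓘(ℝ, E) 𝓘(ℝ, E) (extChartAt 𝓘(ℝ, E) p) p z : E) = z :=
    congrArg (fun f : E →L[ℝ] E => f z) (mfderiv_extChartAt_self (I := 𝓘(ℝ, E)) (x := p))
  refine congrArg (_root_.extDeriv (η.inChart p) (extChartAt 𝓘(ℝ, E) p p))
    (funext fun i => ?_)
  fin_cases i
  · exact h u
  · exact h w

end Charts

/-! ### The form `dW - S^*η` in a product chart -/

noncomputable section Product

open scoped Topology

variable {EM EN EL : Type*}
  [NormedAddCommGroup EM] [NormedSpace ℝ EM]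
  [NormedAddCommGroup EN] [NormedSpace ℝ EN]
  [NormedAddCommGroup EL] [NormedSpace ℝ EL]
  {M N L : Type*}
  [TopologicalSpace M] [ChartedSpace EM M]
  [TopologicalSpace N] [ChartedSpace EN N]
  [TopologicalSpace L] [ChartedSpace EL L]

/-- The product of the charts at `q.1` and `q.2`. -/
def prodChart (EN EL : Type*) [NormedAddCommGroup EN] [NormedSpace ℝ EN]
    [NormedAddCommGroup EL] [NormedSpace ℝ EL] [ChartedSpace EN N] [ChartedSpace EL L]
    (q q' : N × L) : EN × EL :=
  (extChartAt 𝓘(ℝ, EN) q.1 q'.1, extChartAt 𝓘(ℝ, EL) q.2 q'.2)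

/-- The inverse of the product of the charts at `q.1` and `q.2`. -/
def prodChartSymm (q : N × L) (x : EN × EL) : N × L :=
  ((extChartAt 𝓘(ℝ, EN) q.1).symm x.1, (extChartAt 𝓘(ℝ, EL) q.2).symm x.2)

theorem prodChartSymm_prodChart {q q' : N × L} (h1 : q'.1 ∈ (chartAt EN q.1).source)
    (h2 : q'.2 ∈ (chartAt EL q.2).source) : prodChartSymm q (prodChart EN EL q q') = q' :=
  Prod.ext ((extChartAt 𝓘(ℝ, EN) q.1).left_inv (by rwa [extChartAt_source]))
    ((extChartAt 𝓘(ℝ, EL) q.2).left_inv (by rwa [extChartAt_source]))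

theorem prodChartSymm_self (q : N × L) : prodChartSymm q (prodChart EN EL q q) = q :=
  prodChartSymm_prodChart (mem_chart_source EN q.1) (mem_chart_source EL q.2)

/-- A map `S : N × L → M` in the charts at `q` and `S q`. -/
def mapInCharts (EM EN EL : Type*) [NormedAddCommGroup EM] [NormedSpace ℝ EM]
    [NormedAddCommGroup EN] [NormedSpace ℝ EN]
    [NormedAddCommGroup EL] [NormedSpace ℝ EL] [ChartedSpace EM M] [ChartedSpace EN N]
    [ChartedSpace EL L] (S : N × L → M) (q : N × L) (x : EN × EL) : EM :=
  extChartAt 𝓘(ℝ, EM) (S q) (S (prodChartSymm q x))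

/-- The form `dW - S^*η` in the chart at `q`. -/
def defectForm (EN EL : Type*)
    [NormedAddCommGroup EN] [NormedSpace ℝ EN]
    [NormedAddCommGroup EL] [NormedSpace ℝ EL] [ChartedSpace EN N]
    [ChartedSpace EL L] (η : OneForm EM M) (S : N × L → M) (W : N × L → ℝ) (q : N × L)
    (x : EN × EL) : EN × EL →L[ℝ] ℝ :=
  fderiv ℝ (fun y : EN × EL => W (prodChartSymm q y)) x -
    (η.chartForm (S q) (mapInCharts EM EN EL S q x)).comp (fderiv ℝ (mapInCharts EM EN EL S q) x)

variable [IsManifold 𝓘(ℝ, EN) ∞ N] [IsManifold 𝓘(ℝ, EL) ∞ L]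

theorem contMDiffAt_prodChart {q q' : N × L} (h1 : q'.1 ∈ (chartAt EN q.1).source)
    (h2 : q'.2 ∈ (chartAt EL q.2).source) :
    ContMDiffAt (𝓘(ℝ, EN).prod 𝓘(ℝ, EL)) 𝓘(ℝ, EN × EL) ∞ (prodChart EN EL q) q' :=
  ContMDiffAt.prodMk_space ((contMDiffAt_extChartAt' h1).comp q' contMDiffAt_fst)
    ((contMDiffAt_extChartAt' h2).comp q' contMDiffAt_snd)

theorem contMDiffAt_prodChartSymm (q : N × L) :
    ContMDiffAt 𝓘(ℝ, EN × EL) (𝓘(ℝ, EN).prod 𝓘(ℝ, EL)) ∞ (prodChartSymm q)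
      (prodChart EN EL q q) :=
  ContMDiffAt.prodMk
    ((contMDiffAt_extChartAt_symm_self q.1).comp (prodChart EN EL q q)
      contDiffAt_fst.contMDiffAt)
    ((contMDiffAt_extChartAt_symm_self q.2).comp (prodChart EN EL q q)
      contDiffAt_snd.contMDiffAt)

theorem hasMFDerivAt_prodChartSymm {q : N × L} {x : EN × EL}
    (h1 : x.1 ∈ (extChartAt 𝓘(ℝ, EN) q.1).target)
    (h2 : x.2 ∈ (extChartAt 𝓘(ℝ, EL) q.2).target) :
    HasMFDerivAt 𝓘(ℝ, EN × EL) (𝓘(ℝ, EN).prod 𝓘(ℝ, EL)) (prodChartSymm q) x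
      (ContinuousLinearMap.prodMap
        (mfderiv 𝓘(ℝ, EN) 𝓘(ℝ, EN) (extChartAt 𝓘(ℝ, EN) q.1).symm x.1 : EN →L[ℝ] EN)
        (mfderiv 𝓘(ℝ, EL) 𝓘(ℝ, EL) (extChartAt 𝓘(ℝ, EL) q.2).symm x.2 : EL →L[ℝ] EL)) := by
  have d1 := (mdifferentiableAt_extChartAt_symm_self h1).hasMFDerivAt
  have d2 := (mdifferentiableAt_extChartAt_symm_self h2).hasMFDerivAt
  exact (HasMFDerivAt.comp x d1
    (hasFDerivAt_fst (𝕜 := ℝ) (E := EN) (F := EL) (p := x)).hasMFDerivAt).prodMk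
    (HasMFDerivAt.comp x d2
      (hasFDerivAt_snd (𝕜 := ℝ) (E := EN) (F := EL) (p := x)).hasMFDerivAt)

theorem contDiffAt_comp_prodChartSymm {W : N × L → ℝ}
    (hW : ContMDiff (𝓘(ℝ, EN).prod 𝓘(ℝ, EL)) 𝓘(ℝ, ℝ) ∞ W) (q : N × L) :
    ContDiffAt ℝ ∞ (fun y : EN × EL => W (prodChartSymm q y)) (prodChart EN EL q q) :=
  ((hW _).comp _ (contMDiffAt_prodChartSymm q)).contDiffAt

theorem contDiffAt_mapInCharts {S : N × L → M}
    (hS : ContMDiff (𝓘(ℝ, EN).prod 𝓘(ℝ, EL)) 𝓘(ℝ, EM) ∞ S) (q : N × L) :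
    ContDiffAt ℝ ∞ (mapInCharts EM EN EL S q) (prodChart EN EL q q) := by
  refine ContMDiffAt.contDiffAt (ContMDiffAt.comp (g := extChartAt 𝓘(ℝ, EM) (S q))
    (f := fun x => S (prodChartSymm q x)) (I' := 𝓘(ℝ, EM)) _ ?_
      ((hS _).comp _ (contMDiffAt_prodChartSymm q)))
  rw [prodChartSymm_self]
  exact contMDiffAt_extChartAt

variable [IsManifold 𝓘(ℝ, EM) ∞ M]

theorem contDiffAt_defectForm {η : OneForm EM M} (hη : η.IsSmooth) {S : N × L → M}
    (hS : ContMDiff (𝓘(ℝ, EN).prod 𝓘(ℝ, EL)) 𝓘(ℝ, EM) ∞ S) {W : N × L → ℝ}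
    (hW : ContMDiff (𝓘(ℝ, EN).prod 𝓘(ℝ, EL)) 𝓘(ℝ, ℝ) ∞ W) (q : N × L) :
    ContDiffAt ℝ ∞ (defectForm EN EL η S W q) (prodChart EN EL q q) := by
  have h1 := contDiffAt_comp_prodChartSymm hW q
  have h2 := contDiffAt_mapInCharts hS q
  have h3 := hη.contDiffAt_chartForm (S q)
  have h4 : mapInCharts EM EN EL S q (prodChart EN EL q q) =
      extChartAt 𝓘(ℝ, EM) (S q) (S q) := by
    rw [mapInCharts, prodChartSymm_self]
  rw [← h4] at h3
  exact (h1.fderiv_right (by norm_cast)).sub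
    ((h3.comp _ h2).clm_comp (h2.fderiv_right (by norm_cast)))

/-- The chart expression represents the intrinsic form on a whole neighbourhood, as is needed in
order to differentiate it. -/
theorem eventually_defectForm_apply (η : OneForm EM M) {S : N × L → M}
    (hS : ContMDiff (𝓘(ℝ, EN).prod 𝓘(ℝ, EL)) 𝓘(ℝ, EM) ∞ S) {W : N × L → ℝ}
    (hW : ContMDiff (𝓘(ℝ, EN).prod 𝓘(ℝ, EL)) 𝓘(ℝ, ℝ) ∞ W) (q : N × L) :
    ∀ᶠ x in 𝓝 (prodChart EN EL q q), ∀ u : EN × EL,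
      defectForm EN EL η S W q x u =
        (differential (𝓘(ℝ, EN).prod 𝓘(ℝ, EL)) W (prodChartSymm q x) -
          η.pullback (𝓘(ℝ, EN).prod 𝓘(ℝ, EL)) S (prodChartSymm q x))
        (((mfderiv 𝓘(ℝ, EN) 𝓘(ℝ, EN) (extChartAt 𝓘(ℝ, EN) q.1).symm x.1 : EN →L[ℝ] EN) u.1,
          (mfderiv 𝓘(ℝ, EL) 𝓘(ℝ, EL) (extChartAt 𝓘(ℝ, EL) q.2).symm x.2 : EL →L[ℝ] EL) u.2) :
            EN × EL) := by
  have e1 : ∀ᶠ x in 𝓝 (prodChart EN EL q q), x.1 ∈ (extChartAt 𝓘(ℝ, EN) q.1).target :=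
    continuousAt_fst.eventually_mem (extChartAt_target_mem_nhds (I := 𝓘(ℝ, EN)) q.1)
  have e2 : ∀ᶠ x in 𝓝 (prodChart EN EL q q), x.2 ∈ (extChartAt 𝓘(ℝ, EL) q.2).target :=
    continuousAt_snd.eventually_mem (extChartAt_target_mem_nhds (I := 𝓘(ℝ, EL)) q.2)
  have e3 : ∀ᶠ x in 𝓝 (prodChart EN EL q q),
      S (prodChartSymm q x) ∈ (extChartAt 𝓘(ℝ, EM) (S q)).source := by
    have hc := (hS.continuous.continuousAt).comp
      (contMDiffAt_prodChartSymm (EN := EN) (EL := EL) q).continuousAt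
    refine hc.eventually_mem ?_
    rw [Function.comp_apply, prodChartSymm_self]
    exact extChartAt_source_mem_nhds (S q)
  filter_upwards [e1, e2, e3] with x h1 h2 h3 u
  have dκ := hasMFDerivAt_prodChartSymm h1 h2
  let A : EN × EL →L[ℝ] EN × EL := ContinuousLinearMap.prodMap
    (mfderiv 𝓘(ℝ, EN) 𝓘(ℝ, EN) (extChartAt 𝓘(ℝ, EN) q.1).symm x.1 : EN →L[ℝ] EN)
    (mfderiv 𝓘(ℝ, EL) 𝓘(ℝ, EL) (extChartAt 𝓘(ℝ, EL) q.2).symm x.2 : EL →L[ℝ] EL)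
  let BW : EN × EL →L[ℝ] ℝ :=
    mfderiv (𝓘(ℝ, EN).prod 𝓘(ℝ, EL)) 𝓘(ℝ, ℝ) W (prodChartSymm q x)
  let BS : EN × EL →L[ℝ] EM :=
    mfderiv (𝓘(ℝ, EN).prod 𝓘(ℝ, EL)) 𝓘(ℝ, EM) S (prodChartSymm q x)
  let C : EM →L[ℝ] EM :=
    mfderiv 𝓘(ℝ, EM) 𝓘(ℝ, EM) (extChartAt 𝓘(ℝ, EM) (S q)) (S (prodChartSymm q x))
  have dW := (hW.mdifferentiableAt (by simp) : MDifferentiableAt _ _ W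
    (prodChartSymm q x)).hasMFDerivAt.comp x dκ
  have dS := (hS.mdifferentiableAt (by simp) : MDifferentiableAt _ _ S
    (prodChartSymm q x)).hasMFDerivAt.comp x dκ
  have h3' := h3
  rw [extChartAt_source] at h3'
  have dS' := HasMFDerivAt.comp x (mdifferentiableAt_extChartAt (I := 𝓘(ℝ, EM)) h3').hasMFDerivAt
    dS
  have fW : HasFDerivAt (fun y : EN × EL => W (prodChartSymm q y)) (BW.comp A) x :=
    dW.hasFDerivAt
  have fS : HasFDerivAt (mapInCharts EM EN EL S q) (C.comp (BS.comp A)) x := dS'.hasFDerivAt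
  rw [defectForm, fW.fderiv, fS.fderiv]
  -- The differential `C` of the chart at `S q` cancels against the inverse chart inside
  -- `chartForm`.
  exact congrArg (BW (A u) - ·) (η.chartForm_mfderiv h3 (BS (A u)))

end Product

/-! ### Vanishing along the leaves, and `φ` as the remaining component -/

section Product

open scoped Topology

variable {EM EN EL : Type*}
  [NormedAddCommGroup EM] [NormedSpace ℝ EM]
  [NormedAddCommGroup EN] [NormedSpace ℝ EN]
  [NormedAddCommGroup EL] [NormedSpace ℝ EL]
  {M N L : Type*}
  [TopologicalSpace M] [ChartedSpace EM M]
  [TopologicalSpace N] [ChartedSpace EN N]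
  [TopologicalSpace L] [ChartedSpace EL L]

theorem mfderiv_partial_left {F : Type*} [NormedAddCommGroup F] [NormedSpace ℝ F] {Q : Type*}
    [TopologicalSpace Q] [ChartedSpace F Q] {f : N × L → Q} {p : N} {l : L}
    (hf : MDifferentiableAt (𝓘(ℝ, EN).prod 𝓘(ℝ, EL)) 𝓘(ℝ, F) f (p, l)) (v : EN) :
    (mfderiv 𝓘(ℝ, EN) 𝓘(ℝ, F) (fun p' => f (p', l)) p v : F) =
      mfderiv (𝓘(ℝ, EN).prod 𝓘(ℝ, EL)) 𝓘(ℝ, F) f (p, l) ((v, 0) : EN × EL) := by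
  have h : MDifferentiableAt 𝓘(ℝ, EN) (𝓘(ℝ, EN).prod 𝓘(ℝ, EL)) (fun p' : N => (p', l)) p :=
    mdifferentiableAt_id.prodMk mdifferentiableAt_const
  have := mfderiv_comp p hf h
  rw [mfderiv_prod_left] at this
  exact congrArg (fun g : EN →L[ℝ] F => g v) this

theorem sub_pullback_inl_eq_zero {η : OneForm EM M} {S : N × L → M}
    (hS : ContMDiff (𝓘(ℝ, EN).prod 𝓘(ℝ, EL)) 𝓘(ℝ, EM) ∞ S) {W : N × L → ℝ}
    (hW : ContMDiff (𝓘(ℝ, EN).prod 𝓘(ℝ, EL)) 𝓘(ℝ, ℝ) ∞ W)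
    (hdW : ∀ (l : L) (p : N), differential 𝓘(ℝ, EN) (fun p' : N => W (p', l)) p =
      η.pullback 𝓘(ℝ, EN) (fun p' : N => S (p', l)) p) (q : N × L) (v : EN) :
    (differential (𝓘(ℝ, EN).prod 𝓘(ℝ, EL)) W q -
      η.pullback (𝓘(ℝ, EN).prod 𝓘(ℝ, EL)) S q) ((v, 0) : EN × EL) = 0 := by
  obtain ⟨p, l⟩ := q
  have h1 := mfderiv_partial_left (hW.mdifferentiableAt (by simp) (x := (p, l))) v
  have h2 := mfderiv_partial_left (hS.mdifferentiableAt (by simp) (x := (p, l))) v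
  have h3 : (mfderiv 𝓘(ℝ, EN) 𝓘(ℝ, ℝ) (fun p' => W (p', l)) p v : ℝ) =
      η (S (p, l)) (mfderiv 𝓘(ℝ, EN) 𝓘(ℝ, EM) (fun p' => S (p', l)) p v) :=
    congrArg (fun g : EN →L[ℝ] ℝ => g v) (hdW l p)
  rw [h1] at h3
  exact sub_eq_zero.2 (h3.trans (congrArg (η (S (p, l)) : EM →L[ℝ] ℝ) h2))

variable [IsManifold 𝓘(ℝ, EM) ∞ M] [IsManifold 𝓘(ℝ, EN) ∞ N] [IsManifold 𝓘(ℝ, EL) ∞ L]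

/-- All the charts involved have identity differential at their centres. -/
theorem fderiv_mapInCharts_self {S : N × L → M}
    (hS : ContMDiff (𝓘(ℝ, EN).prod 𝓘(ℝ, EL)) 𝓘(ℝ, EM) ∞ S) (q : N × L) :
    fderiv ℝ (mapInCharts EM EN EL S q) (prodChart EN EL q q) =
      (mfderiv (𝓘(ℝ, EN).prod 𝓘(ℝ, EL)) 𝓘(ℝ, EM) S q : EN × EL →L[ℝ] EM) := by
  have dκ := hasMFDerivAt_prodChartSymm (q := q) (x := prodChart EN EL q q)
    (mem_extChartAt_target q.1) (mem_extChartAt_target q.2)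
  have dS : HasMFDerivAt (𝓘(ℝ, EN).prod 𝓘(ℝ, EL)) 𝓘(ℝ, EM) S
      (prodChartSymm q (prodChart EN EL q q))
      (mfderiv (𝓘(ℝ, EN).prod 𝓘(ℝ, EL)) 𝓘(ℝ, EM) S q : EN × EL →L[ℝ] EM) := by
    rw [prodChartSymm_self]
    exact (hS.mdifferentiableAt (by simp)).hasMFDerivAt
  have dC : HasMFDerivAt 𝓘(ℝ, EM) 𝓘(ℝ, EM) (extChartAt 𝓘(ℝ, EM) (S q))
      (S (prodChartSymm q (prodChart EN EL q q))) (ContinuousLinearMap.id ℝ EM) := by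
    rw [prodChartSymm_self, show ContinuousLinearMap.id ℝ EM = _ from
      (mfderiv_extChartAt_self (I := 𝓘(ℝ, EM)) (x := S q)).symm]
    exact (mdifferentiableAt_extChartAt (mem_chart_source EM (S q))).hasMFDerivAt
  have h : ContinuousLinearMap.prodMap
      (mfderiv 𝓘(ℝ, EN) 𝓘(ℝ, EN) (extChartAt 𝓘(ℝ, EN) q.1).symm (prodChart EN EL q q).1 :
        EN →L[ℝ] EN)
      (mfderiv 𝓘(ℝ, EL) 𝓘(ℝ, EL) (extChartAt 𝓘(ℝ, EL) q.2).symm (prodChart EN EL q q).2 :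
        EL →L[ℝ] EL) = ContinuousLinearMap.id ℝ (EN × EL) := by
    rw [show (mfderiv 𝓘(ℝ, EN) 𝓘(ℝ, EN) (extChartAt 𝓘(ℝ, EN) q.1).symm
        (prodChart EN EL q q).1 : EN →L[ℝ] EN) = ContinuousLinearMap.id ℝ EN from
        mfderiv_extChartAt_symm_self q.1,
      show (mfderiv 𝓘(ℝ, EL) 𝓘(ℝ, EL) (extChartAt 𝓘(ℝ, EL) q.2).symm
        (prodChart EN EL q q).2 : EL →L[ℝ] EL) = ContinuousLinearMap.id ℝ EL from
        mfderiv_extChartAt_symm_self q.2]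
    rfl
  have d := HasMFDerivAt.comp (prodChart EN EL q q) dC (dS.comp _ (dκ.congr_mfderiv h))
  have d' : HasFDerivAt (mapInCharts EM EN EL S q)
      ((ContinuousLinearMap.id ℝ EM).comp
        ((mfderiv (𝓘(ℝ, EN).prod 𝓘(ℝ, EL)) 𝓘(ℝ, EM) S q : EN × EL →L[ℝ] EM).comp
          (ContinuousLinearMap.id ℝ (EN × EL))))
      (prodChart EN EL q q) := d.hasFDerivAt
  exact d'.fderiv

theorem eventually_defectForm_inl {η : OneForm EM M} {S : N × L → M}
    (hS : ContMDiff (𝓘(ℝ, EN).prod 𝓘(ℝ, EL)) 𝓘(ℝ, EM) ∞ S) {W : N × L → ℝ}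
    (hW : ContMDiff (𝓘(ℝ, EN).prod 𝓘(ℝ, EL)) 𝓘(ℝ, ℝ) ∞ W)
    (hdW : ∀ (l : L) (p : N), differential 𝓘(ℝ, EN) (fun p' : N => W (p', l)) p =
      η.pullback 𝓘(ℝ, EN) (fun p' : N => S (p', l)) p) (q : N × L) (v : EN) :
    ∀ᶠ x in 𝓝 (prodChart EN EL q q), defectForm EN EL η S W q x ((v, 0) : EN × EL) = 0 := by
  filter_upwards [eventually_defectForm_apply η hS hW q] with x hx
  rw [hx]
  let A : EN →L[ℝ] EN := mfderiv 𝓘(ℝ, EN) 𝓘(ℝ, EN) (extChartAt 𝓘(ℝ, EN) q.1).symm x.1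
  let B : EL →L[ℝ] EL := mfderiv 𝓘(ℝ, EL) 𝓘(ℝ, EL) (extChartAt 𝓘(ℝ, EL) q.2).symm x.2
  have h0 : (A v, B 0) = (A v, 0) := Prod.ext rfl (map_zero B)
  exact (congrArg (fun u : EN × EL => (differential (𝓘(ℝ, EN).prod 𝓘(ℝ, EL)) W
    (prodChartSymm q x) - η.pullback (𝓘(ℝ, EN).prod 𝓘(ℝ, EL)) S (prodChartSymm q x)) u)
      h0).trans (sub_pullback_inl_eq_zero hS hW hdW _ (A v))

/-- Transfers smoothness and derivatives from `defectForm` to `φ`: the left side is `φ` in the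
cotangent trivialisation at `q.2`. -/
theorem eventually_comp_eq_defectForm_inr {η : OneForm EM M} {S : N × L → M}
    (hS : ContMDiff (𝓘(ℝ, EN).prod 𝓘(ℝ, EL)) 𝓘(ℝ, EM) ∞ S) {W : N × L → ℝ}
    (hW : ContMDiff (𝓘(ℝ, EN).prod 𝓘(ℝ, EL)) 𝓘(ℝ, ℝ) ∞ W)
    {φ : (q : N × L) → (TangentSpace 𝓘(ℝ, EL) q.2 →L[ℝ] ℝ)}
    (hφ : ∀ (q : N × L) (z : TangentSpace 𝓘(ℝ, EL) q.2),
      φ q z = (differential (𝓘(ℝ, EN).prod 𝓘(ℝ, EL)) W q -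
        η.pullback (𝓘(ℝ, EN).prod 𝓘(ℝ, EL)) S q) ((0, z) : EN × EL)) (q : N × L) :
    ∀ᶠ q' in 𝓝 q, ((φ q').comp (mfderiv 𝓘(ℝ, EL) 𝓘(ℝ, EL) (extChartAt 𝓘(ℝ, EL) q.2).symm
        (extChartAt 𝓘(ℝ, EL) q.2 q'.2)) : EL →L[ℝ] ℝ) =
      (defectForm EN EL η S W q (prodChart EN EL q q')).comp (ContinuousLinearMap.inr ℝ EN EL) := by
  have hc := (contMDiffAt_prodChart (q := q) (q' := q) (mem_chart_source EN q.1)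
    (mem_chart_source EL q.2)).continuousAt
  filter_upwards [hc.eventually (eventually_defectForm_apply η hS hW q),
    continuousAt_fst.eventually_mem (chart_source_mem_nhds EN q.1),
    continuousAt_snd.eventually_mem (chart_source_mem_nhds EL q.2)] with q' h h1 h2
  ext z
  -- Stated for a variable point `q₁` so that the equality of base points can be substituted despite
  -- the dependent types.
  have hκ : ∀ q₁ : N × L, q₁ = q' → ∀ u : EN × EL,
      (differential (𝓘(ℝ, EN).prod 𝓘(ℝ, EL)) W q₁ -
        η.pullback (𝓘(ℝ, EN).prod 𝓘(ℝ, EL)) S q₁) u =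
      (differential (𝓘(ℝ, EN).prod 𝓘(ℝ, EL)) W q' -
        η.pullback (𝓘(ℝ, EN).prod 𝓘(ℝ, EL)) S q') u := by
    rintro _ rfl u
    rfl
  have e := h ((0, z) : EN × EL)
  let A : EN →L[ℝ] EN :=
    mfderiv 𝓘(ℝ, EN) 𝓘(ℝ, EN) (extChartAt 𝓘(ℝ, EN) q.1).symm (prodChart EN EL q q').1
  let B : EL →L[ℝ] EL :=
    mfderiv 𝓘(ℝ, EL) 𝓘(ℝ, EL) (extChartAt 𝓘(ℝ, EL) q.2).symm (prodChart EN EL q q').2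
  have h0 : (0, B z) = (A 0, B z) := Prod.ext (map_zero A).symm rfl
  exact (hφ q' (B z)).trans ((congrArg (fun u : EN × EL => (differential
    (𝓘(ℝ, EN).prod 𝓘(ℝ, EL)) W q' - η.pullback (𝓘(ℝ, EN).prod 𝓘(ℝ, EL)) S q') u)
      h0).trans (e.trans (hκ _ (prodChartSymm_prodChart h1 h2) _)).symm)

theorem contMDiff_cotangent_section {η : OneForm EM M} (hη : η.IsSmooth) {S : N × L → M}
    (hS : ContMDiff (𝓘(ℝ, EN).prod 𝓘(ℝ, EL)) 𝓘(ℝ, EM) ∞ S) {W : N × L → ℝ}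
    (hW : ContMDiff (𝓘(ℝ, EN).prod 𝓘(ℝ, EL)) 𝓘(ℝ, ℝ) ∞ W)
    {φ : (q : N × L) → (TangentSpace 𝓘(ℝ, EL) q.2 →L[ℝ] ℝ)}
    (hφ : ∀ (q : N × L) (z : TangentSpace 𝓘(ℝ, EL) q.2),
      φ q z = (differential (𝓘(ℝ, EN).prod 𝓘(ℝ, EL)) W q -
        η.pullback (𝓘(ℝ, EN).prod 𝓘(ℝ, EL)) S q) ((0, z) : EN × EL)) :
    ContMDiff (𝓘(ℝ, EN).prod 𝓘(ℝ, EL)) (𝓘(ℝ, EL).prod 𝓘(ℝ, EL →L[ℝ] ℝ)) ∞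
      (fun q : N × L => (⟨q.2, φ q⟩ : CotangentBundle EL L)) := by
  intro q
  refine (contMDiffAt_hom_bundle _).2 ⟨contMDiffAt_snd, ?_⟩
  have h1 : ContMDiffAt (𝓘(ℝ, EN).prod 𝓘(ℝ, EL)) 𝓘(ℝ, EL →L[ℝ] ℝ) ∞ (fun q' : N × L =>
      (defectForm EN EL η S W q (prodChart EN EL q q')).comp
        (ContinuousLinearMap.inr ℝ EN EL)) q :=
    ((contDiffAt_defectForm hη hS hW q).clm_comp contDiffAt_const).contMDiffAt.comp q
      (contMDiffAt_prodChart (mem_chart_source EN q.1) (mem_chart_source EL q.2))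
  refine h1.congr_of_eventuallyEq ?_
  filter_upwards [eventually_comp_eq_defectForm_inr hS hW hφ q,
    continuousAt_snd.eventually_mem (chart_source_mem_nhds EL q.2)] with q' h h2
  exact (inCoordinates_cotangent h2 (φ q')).trans h

/-- The derivative of `dW - S^*η` along the leaves of constant `l`, paired with `(0, z)`. -/
theorem fderiv_defectForm_inl_inr {η : OneForm EM M} (hη : η.IsSmooth) {S : N × L → M}
    (hS : ContMDiff (𝓘(ℝ, EN).prod 𝓘(ℝ, EL)) 𝓘(ℝ, EM) ∞ S) {W : N × L → ℝ}
    (hW : ContMDiff (𝓘(ℝ, EN).prod 𝓘(ℝ, EL)) 𝓘(ℝ, ℝ) ∞ W)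
    (hdW : ∀ (l : L) (p : N), differential 𝓘(ℝ, EN) (fun p' : N => W (p', l)) p =
      η.pullback 𝓘(ℝ, EN) (fun p' : N => S (p', l)) p) (q : N × L) (v : EN) (w : EN × EL) :
    fderiv ℝ (defectForm EN EL η S W q) (prodChart EN EL q q) (v, 0) w =
      -η.extDeriv (S q) ![mfderiv (𝓘(ℝ, EN).prod 𝓘(ℝ, EL)) 𝓘(ℝ, EM) S q ((v, 0) : EN × EL),
        mfderiv (𝓘(ℝ, EN).prod 𝓘(ℝ, EL)) 𝓘(ℝ, EM) S q w] := by
  have hm : mapInCharts EM EN EL S q (prodChart EN EL q q) =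
      extChartAt 𝓘(ℝ, EM) (S q) (S q) := by
    rw [mapInCharts, prodChartSymm_self]
  have hθ : DifferentiableAt ℝ (η.chartForm (S q))
      (mapInCharts EM EN EL S q (prodChart EN EL q q)) := by
    rw [hm]
    exact (hη.contDiffAt_chartForm (S q)).differentiableAt (by simp)
  have key := fderiv_sub_pullback_antisymm (contDiffAt_comp_prodChartSymm hW q)
    (contDiffAt_mapInCharts hS q) hθ (v, 0) w
  have ha := (contDiffAt_defectForm hη hS hW q).differentiableAt (by simp)
  -- The form vanishes on `(v, 0)` throughout a neighbourhood, so its derivative in any direction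
  -- `w`, evaluated on `(v, 0)`, is zero.
  have hz : fderiv ℝ (defectForm EN EL η S W q) (prodChart EN EL q q) w (v, 0) = 0 := by
    have h1 := ha.hasFDerivAt.clm_apply
      (hasFDerivAt_const (𝕜 := ℝ) ((v, 0) : EN × EL) (prodChart EN EL q q))
    have h2 : HasFDerivAt (fun x => defectForm EN EL η S W q x ((v, 0) : EN × EL)) 0
        (prodChart EN EL q q) :=
      (hasFDerivAt_const (𝕜 := ℝ) (0 : ℝ) (prodChart EN EL q q)).congr_of_eventuallyEq
        (eventually_defectForm_inl hS hW hdW q v)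
    simpa using congrArg (fun f : EN × EL →L[ℝ] ℝ => f w) (HasFDerivAt.unique h1 h2)
  change fderiv ℝ (defectForm EN EL η S W q) (prodChart EN EL q q) (v, 0) w -
    fderiv ℝ (defectForm EN EL η S W q) (prodChart EN EL q q) w (v, 0) = _ at key
  rw [hz, sub_zero] at key
  rw [key, hm, fderiv_mapInCharts_self hS]
  exact congrArg Neg.neg (OneForm.extDeriv_apply η (S q) _ _).symm

end Product

/-! ### Injectivity of the differentials -/

section Immersion

open scoped Topology

variable {EM EN EL : Type*}
  [NormedAddCommGroup EM] [NormedSpace ℝ EM]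
  [NormedAddCommGroup EN] [NormedSpace ℝ EN]
  [NormedAddCommGroup EL] [NormedSpace ℝ EL]
  {M N L : Type*}
  [TopologicalSpace M] [ChartedSpace EM M]
  [TopologicalSpace N] [ChartedSpace EN N] [IsManifold 𝓘(ℝ, EN) ∞ N]
  [TopologicalSpace L] [ChartedSpace EL L] [IsManifold 𝓘(ℝ, EL) ∞ L]

theorem hasMFDerivAt_prodChart_self (q : N × L) :
    HasMFDerivAt (𝓘(ℝ, EN).prod 𝓘(ℝ, EL)) 𝓘(ℝ, EN × EL) (prodChart EN EL q) q
      (ContinuousLinearMap.id ℝ (EN × EL)) := by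
  have d1 : HasMFDerivAt 𝓘(ℝ, EN) 𝓘(ℝ, EN) (extChartAt 𝓘(ℝ, EN) q.1) q.1
      (ContinuousLinearMap.id ℝ EN) :=
    (mdifferentiableAt_extChartAt (mem_chart_source EN q.1)).hasMFDerivAt.congr_mfderiv
      (mfderiv_extChartAt_self (I := 𝓘(ℝ, EN)))
  have d2 : HasMFDerivAt 𝓘(ℝ, EL) 𝓘(ℝ, EL) (extChartAt 𝓘(ℝ, EL) q.2) q.2
      (ContinuousLinearMap.id ℝ EL) :=
    (mdifferentiableAt_extChartAt (mem_chart_source EL q.2)).hasMFDerivAt.congr_mfderiv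
      (mfderiv_extChartAt_self (I := 𝓘(ℝ, EL)))
  have c1 := d1.comp q (hasMFDerivAt_fst (I := 𝓘(ℝ, EN)) (I' := 𝓘(ℝ, EL)) q)
  have c2 := d2.comp q (hasMFDerivAt_snd (I := 𝓘(ℝ, EN)) (I' := 𝓘(ℝ, EL)) q)
  exact ⟨c1.1.prodMk c2.1, c1.2.prodMk c2.2⟩

variable [IsManifold 𝓘(ℝ, EM) ∞ M]

/-- The derivative of `φ` in the chart at `q`. -/
theorem hasMFDerivAt_defectForm_inr {η : OneForm EM M} (hη : η.IsSmooth) {S : N × L → M}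
    (hS : ContMDiff (𝓘(ℝ, EN).prod 𝓘(ℝ, EL)) 𝓘(ℝ, EM) ∞ S) {W : N × L → ℝ}
    (hW : ContMDiff (𝓘(ℝ, EN).prod 𝓘(ℝ, EL)) 𝓘(ℝ, ℝ) ∞ W) (q : N × L) :
    HasMFDerivAt (𝓘(ℝ, EN).prod 𝓘(ℝ, EL)) 𝓘(ℝ, EL →L[ℝ] ℝ) (fun q' : N × L =>
      (defectForm EN EL η S W q (prodChart EN EL q q')).comp (ContinuousLinearMap.inr ℝ EN EL)) q
      (((ContinuousLinearMap.compL ℝ EL (EN × EL) ℝ).flip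
        (ContinuousLinearMap.inr ℝ EN EL)).comp
        (fderiv ℝ (defectForm EN EL η S W q) (prodChart EN EL q q))) := by
  have ha := ((contDiffAt_defectForm hη hS hW q).differentiableAt (by simp)).hasFDerivAt
  have h := (((ContinuousLinearMap.compL ℝ EL (EN × EL) ℝ).flip
    (ContinuousLinearMap.inr ℝ EN EL)).hasFDerivAt.comp (prodChart EN EL q q) ha).hasMFDerivAt
  exact h.comp q (hasMFDerivAt_prodChart_self q)

/-- The core of the argument, shared by both immersions: `S_*(v, 0)` is in the kernel of `dη` and of
`η`, hence zero, and `S_*` is injective. -/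
theorem eq_zero_of_fderiv_defectForm_eq_zero {n : ℕ} {η : OneForm EM M}
    (hη : IsContactForm n η) {S : N × L → M}
    (hS : IsLocalDiffeomorph (𝓘(ℝ, EN).prod 𝓘(ℝ, EL)) 𝓘(ℝ, EM) ∞ S)
    (hiso : IsPseudoIsotropic EN η S) {W : N × L → ℝ}
    (hW : ContMDiff (𝓘(ℝ, EN).prod 𝓘(ℝ, EL)) 𝓘(ℝ, ℝ) ∞ W)
    (hdW : ∀ (l : L) (p : N), differential 𝓘(ℝ, EN) (fun p' : N => W (p', l)) p =
      η.pullback 𝓘(ℝ, EN) (fun p' : N => S (p', l)) p) {q : N × L} {v : EN}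
    (hv : ∀ z : EL,
      fderiv ℝ (defectForm EN EL η S W q) (prodChart EN EL q q) (v, 0) (0, z) = 0)
    (hWv : (mfderiv (𝓘(ℝ, EN).prod 𝓘(ℝ, EL)) 𝓘(ℝ, ℝ) W q ((v, 0) : EN × EL) : ℝ) = 0) :
    v = 0 := by
  obtain ⟨p, l⟩ := q
  have hS' := hS.contMDiff
  let D := hS.mfderivToContinuousLinearEquiv (by simp) (p, l)
  let T : EN × EL →L[ℝ] TangentSpace 𝓘(ℝ, EM) (S (p, l)) :=
    mfderiv (𝓘(ℝ, EN).prod 𝓘(ℝ, EL)) 𝓘(ℝ, EM) S (p, l)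
  have hTinj : Function.Injective T := D.injective
  have hTsurj : Function.Surjective T := D.surjective
  obtain ⟨b, hb⟩ := hη.ne_zero (S (p, l))
  have hpart (w : EN) :
      (mfderiv 𝓘(ℝ, EN) 𝓘(ℝ, EM) (fun p' => S (p', l)) p w : EM) = T (w, 0) :=
    mfderiv_partial_left (hS'.mdifferentiableAt (by simp)) w
  have hβ1 (w : EN) : η.extDeriv (S (p, l)) ![T (v, 0), T (w, 0)] = 0 := by
    have h := congrArg (fun β : EN [⋀^Fin 2]→L[ℝ] ℝ => β ![v, w]) (hiso l p)
    refine Eq.trans (congrArg (η.extDeriv (S (p, l))) (funext fun i => ?_)) h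
    fin_cases i
    · exact (hpart v).symm
    · exact (hpart w).symm
  have hβ2 (z : EL) : η.extDeriv (S (p, l)) ![T (v, 0), T (0, z)] = 0 := by
    have h := fderiv_defectForm_inl_inr hη.isSmooth hS' hW hdW (p, l) v (0, z)
    rw [hv z] at h
    exact neg_eq_zero.1 h.symm
  have hθ : η (S (p, l)) (T (v, 0)) = 0 :=
    (sub_eq_zero.1 (sub_pullback_inl_eq_zero hS' hW hdW (p, l) v)).symm.trans hWv
  have hT : T (v, 0) = 0 := by
    refine eq_zero_of_powWedge_ne_zero hη.finrank_eq hb (fun w => ?_) hθ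
    -- Every tangent vector at `S (p, l)` is `T (w, 0) + T (0, z)`: pseudo-isotropy handles the
    -- first summand, the hypothesis on `φ` the second.
    obtain ⟨⟨w, z⟩, rfl⟩ := hTsurj w
    have hwz : T (w, z) = T (w, 0) + T (0, z) := by rw [← map_add]; simp
    refine (congrArg (fun w' => η.extDeriv (S (p, l)) ![T (v, 0), w']) hwz).trans
      ((map_pair_add_right (η.extDeriv (S (p, l))) (T (v, 0)) (T (w, 0)) (T (0, z))).trans ?_)
    exact (congrArg₂ (· + ·) (hβ1 w) (hβ2 z)).trans (add_zero 0)
  exact congrArg Prod.fst (hTinj (hT.trans (map_zero T).symm))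

theorem mfderiv_comp_apply_eq_zero {E₁ E₂ E₃ : Type*} [NormedAddCommGroup E₁] [NormedSpace ℝ E₁]
    [NormedAddCommGroup E₂] [NormedSpace ℝ E₂] [NormedAddCommGroup E₃] [NormedSpace ℝ E₃]
    {H₁ H₂ H₃ : Type*} [TopologicalSpace H₁] [TopologicalSpace H₂] [TopologicalSpace H₃]
    {I₁ : ModelWithCorners ℝ E₁ H₁} {I₂ : ModelWithCorners ℝ E₂ H₂} {I₃ : ModelWithCorners ℝ E₃ H₃}
    {M₁ M₂ M₃ : Type*} [TopologicalSpace M₁] [ChartedSpace H₁ M₁] [TopologicalSpace M₂]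
    [ChartedSpace H₂ M₂] [TopologicalSpace M₃] [ChartedSpace H₃ M₃] {f : M₁ → M₂} {g : M₂ → M₃}
    {x : M₁} (hg : MDifferentiableAt I₂ I₃ g (f x)) (hf : MDifferentiableAt I₁ I₂ f x)
    {u : TangentSpace I₁ x} (hu : mfderiv I₁ I₂ f x u = 0) :
    mfderiv I₁ I₃ (fun y => g (f y)) x u = 0 := by
  have h := mfderiv_comp_apply (x := x) hg hf u
  rw [hu, map_zero] at h
  exact h

/-- Composing with this fibre coordinate extracts the vertical part of the differential of a map
into the cotangent bundle. -/
theorem mdifferentiableAt_cotangent_inCoordinates (y₀ : CotangentBundle EL L) :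
    MDifferentiableAt (𝓘(ℝ, EL).prod 𝓘(ℝ, EL →L[ℝ] ℝ)) 𝓘(ℝ, EL →L[ℝ] ℝ)
      (fun y : CotangentBundle EL L => ContinuousLinearMap.inCoordinates EL
        (TangentSpace 𝓘(ℝ, EL)) ℝ (fun _ : L => ℝ) y₀.1 y.1 y₀.1 y.1 y.2) y₀ :=
  (((contMDiffAt_hom_bundle (n := ∞) (IB := 𝓘(ℝ, EL))
    (fun y : CotangentBundle EL L => y)).1 contMDiffAt_id).2).mdifferentiableAt (by simp)

theorem isSmoothImmersion_leaf {n : ℕ} {η : OneForm EM M}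
    (hη : IsContactForm n η) {S : N × L → M}
    (hS : IsLocalDiffeomorph (𝓘(ℝ, EN).prod 𝓘(ℝ, EL)) 𝓘(ℝ, EM) ∞ S)
    (hiso : IsPseudoIsotropic EN η S) {W : N × L → ℝ}
    (hW : ContMDiff (𝓘(ℝ, EN).prod 𝓘(ℝ, EL)) 𝓘(ℝ, ℝ) ∞ W)
    (hdW : ∀ (l : L) (p : N), differential 𝓘(ℝ, EN) (fun p' : N => W (p', l)) p =
      η.pullback 𝓘(ℝ, EN) (fun p' : N => S (p', l)) p)
    {φ : (q : N × L) → (TangentSpace 𝓘(ℝ, EL) q.2 →L[ℝ] ℝ)}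
    (hφ : ∀ (q : N × L) (z : TangentSpace 𝓘(ℝ, EL) q.2),
      φ q z = (differential (𝓘(ℝ, EN).prod 𝓘(ℝ, EL)) W q -
        η.pullback (𝓘(ℝ, EN).prod 𝓘(ℝ, EL)) S q) ((0, z) : EN × EL)) (l : L) :
    IsSmoothImmersion 𝓘(ℝ, EN) 𝓘(ℝ, (EL →L[ℝ] ℝ) × ℝ)
      (fun p : N => ((φ (p, l), W (p, l)) : (EL →L[ℝ] ℝ) × ℝ)) := by
  have hS' := hS.contMDiff
  have hincl : ContMDiff 𝓘(ℝ, EN) (𝓘(ℝ, EN).prod 𝓘(ℝ, EL)) ∞ (fun p : N => (p, l)) :=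
    contMDiff_id.prodMk contMDiff_const
  let Φ : N → EL →L[ℝ] ℝ := fun p => φ (p, l)
  -- With `l` fixed, the inverse chart is differentiated only at the image of `l`, where its
  -- differential is the identity; hence `φ_l` needs no trivialisation.
  have hev (p : N) : Φ =ᶠ[𝓝 p] fun p' =>
      (defectForm EN EL η S W (p, l) (prodChart EN EL (p, l) (p', l))).comp
        (ContinuousLinearMap.inr ℝ EN EL) := by
    filter_upwards [(hincl.continuous.continuousAt (x := p)).eventually
      (eventually_comp_eq_defectForm_inr hS' hW hφ (p, l))] with p' h
    refine Eq.trans ?_ h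
    exact (congrArg (fun A : EL →L[ℝ] EL => (φ (p', l) : EL →L[ℝ] ℝ).comp A)
      (mfderiv_extChartAt_symm_self l)).symm
  have hφs : ContMDiff 𝓘(ℝ, EN) 𝓘(ℝ, EL →L[ℝ] ℝ) ∞ Φ := by
    intro p
    refine ContMDiffAt.congr_of_eventuallyEq ?_ (hev p)
    have h1 : ContMDiffAt (𝓘(ℝ, EN).prod 𝓘(ℝ, EL)) 𝓘(ℝ, EL →L[ℝ] ℝ) ∞ (fun q' : N × L =>
        (defectForm EN EL η S W (p, l) (prodChart EN EL (p, l) q')).comp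
          (ContinuousLinearMap.inr ℝ EN EL)) (p, l) :=
      ((contDiffAt_defectForm hη.isSmooth hS' hW (p, l)).clm_comp
        contDiffAt_const).contMDiffAt.comp (p, l)
        (contMDiffAt_prodChart (mem_chart_source EN p) (mem_chart_source EL l))
    exact h1.comp p (hincl p)
  have hWs : ContMDiff 𝓘(ℝ, EN) 𝓘(ℝ, ℝ) ∞ (fun p : N => W (p, l)) := hW.comp hincl
  refine ⟨hφs.prodMk_space hWs, fun p => ?_⟩
  have d1 := (hφs.mdifferentiableAt (by simp) (x := p)).hasMFDerivAt
  have d2 := (hWs.mdifferentiableAt (by simp) (x := p)).hasMFDerivAt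
  have d : HasMFDerivAt 𝓘(ℝ, EN) 𝓘(ℝ, (EL →L[ℝ] ℝ) × ℝ)
      (fun p : N => ((Φ p, W (p, l)) : (EL →L[ℝ] ℝ) × ℝ)) p
      (ContinuousLinearMap.prod
        (mfderiv 𝓘(ℝ, EN) 𝓘(ℝ, EL →L[ℝ] ℝ) Φ p :
          EN →L[ℝ] (EL →L[ℝ] ℝ))
        (mfderiv 𝓘(ℝ, EN) 𝓘(ℝ, ℝ) (fun p : N => W (p, l)) p : EN →L[ℝ] ℝ)) :=
    ⟨d1.1.prodMk d2.1, d1.2.prodMk d2.2⟩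
  let A₁ : EN →L[ℝ] (EL →L[ℝ] ℝ) := mfderiv 𝓘(ℝ, EN) 𝓘(ℝ, EL →L[ℝ] ℝ) Φ p
  let A₂ : EN →L[ℝ] ℝ := mfderiv 𝓘(ℝ, EN) 𝓘(ℝ, ℝ) (fun p : N => W (p, l)) p
  suffices h : ∀ v, A₁.prod A₂ v = 0 → v = 0 by
    rw [d.mfderiv]
    exact (injective_iff_map_eq_zero (A₁.prod A₂)).2 h
  intro v hv
  have hv1 : A₁ v = 0 := congrArg Prod.fst hv
  have hv2 : A₂ v = 0 := congrArg Prod.snd hv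
  refine eq_zero_of_fderiv_defectForm_eq_zero hη hS hiso hW hdW (q := (p, l)) (fun z => ?_)
    ((mfderiv_partial_left (hW.mdifferentiableAt (by simp)) v).symm.trans hv2)
  have hd := hasMFDerivAt_defectForm_inr hη.isSmooth hS' hW (p, l)
  have e := mfderiv_partial_left hd.mdifferentiableAt v
  rw [hd.mfderiv] at e
  have e' := (congrArg (fun f : EN →L[ℝ] (EL →L[ℝ] ℝ) => f v) (hev p).mfderiv_eq).symm.trans hv1
  exact congrArg (fun f : EL →L[ℝ] ℝ => f z) (e.symm.trans e')

theorem isSmoothImmersion_total {n : ℕ} {η : OneForm EM M}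
    (hη : IsContactForm n η) {S : N × L → M}
    (hS : IsLocalDiffeomorph (𝓘(ℝ, EN).prod 𝓘(ℝ, EL)) 𝓘(ℝ, EM) ∞ S)
    (hiso : IsPseudoIsotropic EN η S) {W : N × L → ℝ}
    (hW : ContMDiff (𝓘(ℝ, EN).prod 𝓘(ℝ, EL)) 𝓘(ℝ, ℝ) ∞ W)
    (hdW : ∀ (l : L) (p : N), differential 𝓘(ℝ, EN) (fun p' : N => W (p', l)) p =
      η.pullback 𝓘(ℝ, EN) (fun p' : N => S (p', l)) p)
    {φ : (q : N × L) → (TangentSpace 𝓘(ℝ, EL) q.2 →L[ℝ] ℝ)}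
    (hφ : ∀ (q : N × L) (z : TangentSpace 𝓘(ℝ, EL) q.2),
      φ q z = (differential (𝓘(ℝ, EN).prod 𝓘(ℝ, EL)) W q -
        η.pullback (𝓘(ℝ, EN).prod 𝓘(ℝ, EL)) S q) ((0, z) : EN × EL)) :
    IsSmoothImmersion (𝓘(ℝ, EN).prod 𝓘(ℝ, EL))
      ((𝓘(ℝ, EL).prod 𝓘(ℝ, EL →L[ℝ] ℝ)).prod 𝓘(ℝ, ℝ))
      (fun q : N × L =>
        (((⟨q.2, φ q⟩ : CotangentBundle EL L), W q) : CotangentBundle EL L × ℝ)) := by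
  have hS' := hS.contMDiff
  have hF : ContMDiff (𝓘(ℝ, EN).prod 𝓘(ℝ, EL)) ((𝓘(ℝ, EL).prod 𝓘(ℝ, EL →L[ℝ] ℝ)).prod 𝓘(ℝ, ℝ)) ∞
      (fun q : N × L =>
        (((⟨q.2, φ q⟩ : CotangentBundle EL L), W q) : CotangentBundle EL L × ℝ)) :=
    (contMDiff_cotangent_section hη.isSmooth hS' hW hφ).prodMk hW
  refine ⟨hF, fun q => ?_⟩
  have dF := hF.mdifferentiableAt (by simp) (x := q)
  let A : EN × EL →L[ℝ] (EL × (EL →L[ℝ] ℝ)) × ℝ :=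
    mfderiv (𝓘(ℝ, EN).prod 𝓘(ℝ, EL)) ((𝓘(ℝ, EL).prod 𝓘(ℝ, EL →L[ℝ] ℝ)).prod 𝓘(ℝ, ℝ))
      (fun q : N × L =>
        (((⟨q.2, φ q⟩ : CotangentBundle EL L), W q) : CotangentBundle EL L × ℝ)) q
  suffices h : ∀ u, A u = 0 → u = 0 from (injective_iff_map_eq_zero A).2 h
  rintro ⟨v, z⟩ hu
  have dφ := (contMDiff_cotangent_section hη.isSmooth hS' hW hφ).mdifferentiableAt (by simp) (x := q)
  have hu1 : mfderiv (𝓘(ℝ, EN).prod 𝓘(ℝ, EL)) (𝓘(ℝ, EL).prod 𝓘(ℝ, EL →L[ℝ] ℝ))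
      (fun q : N × L => (⟨q.2, φ q⟩ : CotangentBundle EL L)) q ((v, z) : EN × EL) = 0 :=
    mfderiv_comp_apply_eq_zero (g := Prod.fst) mdifferentiableAt_fst dF hu
  have hu2 : mfderiv (𝓘(ℝ, EN).prod 𝓘(ℝ, EL)) 𝓘(ℝ, ℝ) W q ((v, z) : EN × EL) = 0 :=
    mfderiv_comp_apply_eq_zero (g := Prod.snd) mdifferentiableAt_snd dF hu
  -- The composite of `φ` with the bundle projection is `(p, l) ↦ l`, whose differential sends `(v,
  -- z)` to `z`.
  have hz : z = 0 := by
    have h : mfderiv (𝓘(ℝ, EN).prod 𝓘(ℝ, EL)) 𝓘(ℝ, EL) (fun q : N × L => q.2) q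
        ((v, z) : EN × EL) = 0 :=
      mfderiv_comp_apply_eq_zero (g := TotalSpace.proj) ((contMDiff_proj (n := ∞)
        (IB := 𝓘(ℝ, EL)) (fun p : L => TangentSpace 𝓘(ℝ, EL) p →L[ℝ] ℝ)).mdifferentiableAt
          (by simp)) dφ hu1
    exact (congrArg (fun f : EN × EL →L[ℝ] EL => f (v, z))
      (mfderiv_snd (I := 𝓘(ℝ, EN)) (I' := 𝓘(ℝ, EL)) (x := q))).symm.trans h
  subst hz
  have hv : v = 0 := by
    refine eq_zero_of_fderiv_defectForm_eq_zero hη hS hiso hW hdW (q := q) (fun z => ?_) hu2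
    -- Near `q` the fibre coordinate of `φ` is the `L`-part of the form in the chart, so `hu1` kills
    -- the derivative of that part along `(v, 0)`.
    have hev : (fun q' : N × L => ContinuousLinearMap.inCoordinates EL (TangentSpace 𝓘(ℝ, EL)) ℝ
        (fun _ : L => ℝ) q.2 q'.2 q.2 q'.2 (φ q')) =ᶠ[𝓝 q] fun q' =>
        (defectForm EN EL η S W q (prodChart EN EL q q')).comp
          (ContinuousLinearMap.inr ℝ EN EL) := by
      filter_upwards [eventually_comp_eq_defectForm_inr hS' hW hφ q,
        continuousAt_snd.eventually_mem (chart_source_mem_nhds EL q.2)] with q' h h2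
      exact (inCoordinates_cotangent h2 (φ q')).trans h
    have h := mfderiv_comp_apply_eq_zero (x := q)
      (f := fun q : N × L => (⟨q.2, φ q⟩ : CotangentBundle EL L))
      (mdifferentiableAt_cotangent_inCoordinates (⟨q.2, φ q⟩ : CotangentBundle EL L)) dφ hu1
    have e : mfderiv (𝓘(ℝ, EN).prod 𝓘(ℝ, EL)) 𝓘(ℝ, EL →L[ℝ] ℝ) (fun q' : N × L =>
        ContinuousLinearMap.inCoordinates EL (TangentSpace 𝓘(ℝ, EL)) ℝ
        (fun _ : L => ℝ) q.2 q'.2 q.2 q'.2 (φ q')) q = _ :=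
      hev.mfderiv_eq.trans (hasMFDerivAt_defectForm_inr hη.isSmooth hS' hW q).mfderiv
    exact congrArg (fun f : EL →L[ℝ] ℝ => f z)
      ((congrArg (fun f : EN × EL →L[ℝ] (EL →L[ℝ] ℝ) => f (v, 0)) e).symm.trans h)
  rw [hv]
  rfl

end Immersion

end ContactHJ

theorem mainTheorem8
    {EM EN EL : Type*}
    [NormedAddCommGroup EM] [NormedSpace ℝ EM] [FiniteDimensional ℝ EM]
    [NormedAddCommGroup EN] [NormedSpace ℝ EN] [FiniteDimensional ℝ EN]
    [NormedAddCommGroup EL] [NormedSpace ℝ EL] [FiniteDimensional ℝ EL]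
    {M N L : Type*}
    [TopologicalSpace M] [ChartedSpace EM M] [IsManifold 𝓘(ℝ, EM) ∞ M]
    [TopologicalSpace N] [ChartedSpace EN N] [IsManifold 𝓘(ℝ, EN) ∞ N]
    [TopologicalSpace L] [ChartedSpace EL L] [IsManifold 𝓘(ℝ, EL) ∞ L]
    -- the contact manifold `(M, η)`, the fibration `Π : M → N` and the vector field `X`
    (n : ℕ) (η : ContactHJ.OneForm EM M) (hη : ContactHJ.IsContactForm n η)
    (P : M → N) (hP : ContactHJ.IsFibration 𝓘(ℝ, EM) 𝓘(ℝ, EN) P)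
    (X : (m : M) → TangentSpace 𝓘(ℝ, EM) m)
    (hX : ContMDiff 𝓘(ℝ, EM) 𝓘(ℝ, EM).tangent ∞
      (fun m => (⟨m, X m⟩ : TangentBundle 𝓘(ℝ, EM) M)))
    -- the pseudo-isotropic complete solution
    (S : N × L → M) (hS : ContactHJ.IsCompleteSolution (EN := EN) (EL := EL) P X S)
    (hiso : ContactHJ.IsPseudoIsotropic EN η S)
    -- the smooth function `W` with `dW_l = σ_l^* η` for all `l`
    (W : N × L → ℝ) (hW : ContMDiff (𝓘(ℝ, EN).prod 𝓘(ℝ, EL)) 𝓘(ℝ, ℝ) ∞ W)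
    (hdW : ∀ (l : L) (p : N),
      ContactHJ.differential 𝓘(ℝ, EN) (fun p' : N => W (p', l)) p =
        η.pullback 𝓘(ℝ, EN) (fun p' : N => S (p', l)) p)
    -- the map `φ` with `⟨φ(p, l), z⟩ = ⟨(dW - S^* η)(p, l), (0, z)⟩`
    (φ : (q : N × L) → (TangentSpace 𝓘(ℝ, EL) q.2 →L[ℝ] ℝ))
    (hφ : ∀ (q : N × L) (z : TangentSpace 𝓘(ℝ, EL) q.2),
      φ q z = (ContactHJ.differential (𝓘(ℝ, EN).prod 𝓘(ℝ, EL)) W q -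
        η.pullback (𝓘(ℝ, EN).prod 𝓘(ℝ, EL)) S q) ((0, z) : EN × EL)) :
    -- each `(φ_l, W_l) : N → T_l^* L × ℝ` is an immersion
    (∀ l : L, ContactHJ.IsSmoothImmersion 𝓘(ℝ, EN) 𝓘(ℝ, (EL →L[ℝ] ℝ) × ℝ)
      (fun p : N => ((φ (p, l), W (p, l)) : (EL →L[ℝ] ℝ) × ℝ))) ∧
    -- `(φ, W) : N × L → T^* L × ℝ` is an immersion
    ContactHJ.IsSmoothImmersion (𝓘(ℝ, EN).prod 𝓘(ℝ, EL))
      ((𝓘(ℝ, EL).prod 𝓘(ℝ, EL →L[ℝ] ℝ)).prod 𝓘(ℝ, ℝ))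
      (fun q : N × L =>
        (((⟨q.2, φ q⟩ : ContactHJ.CotangentBundle EL L), W q) :
          ContactHJ.CotangentBundle EL L × ℝ)) := by
  have hd := hS.isLocalDiffeomorph
  exact ⟨ContactHJ.isSmoothImmersion_leaf hη hd hiso hW hdW hφ,
    ContactHJ.isSmoothImmersion_total hη hd hiso hW hdW hφ⟩
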